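/- Let $d\ge 1$, let $\Omega\subset\mathbb{R}^d$ be a bounded open set, and write $\Omega^c=\mathbb{R}^d\setminus\Omega$ and $Q_\Omega=(\mathbb{R}^d\times\mathbb{R}^d)\setminus(\Omega^c\times\Omega^c)$. For a measurable function $w:\mathbb{R}^d\to\mathbb{R}$ put $$\alpha(w)=\lim_{s\to0^+}s\int_{\{|y|\ge 1\}}\frac{w(y)}{|y|^{d+2s}}\,dy$$ whenever the integrals converge absolutely for all small $s>0$ and the limit exists and is finite. Let $\mathcal{A}(\Omega)$ be the set of all $v\in L^\infty(\Omega^c)$ such that $\alpha(v^+)$, $\alpha(v^-)$ and $\alpha(v^2)$ exist, where $v^\pm=\max\{\pm v,0\}$ and these functions are extended by $0$ to $\Omega$. Fix $v\in\mathcal{A}(\Omega)$, let $L^2_{loc}(Q_\Omega,v)$ be the set of all $u\in L^2_{loc}(\mathbb{R}^d)$ with $u=v$ almost everywhere on $\Omega^c$, and for $s\in(0,1)$ define $$F_s(u)=\frac{s}{2}\iint_{Q_\Omega}\frac{|u(x)-u(y)|^2}{|x-y|^{d+2s}}\,dx\,dy\in[0,\infty]\quad\text{if }u\in L^2_{loc}(Q_\Omega,v),\qquad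 F_s(u)=+\infty\quad\text{otherwise}.$$ (i) Let $(u_s)_{s\in(0,1)}\subset L^2_{loc}(Q_\Omega,v)$ satisfy $\sup_{s\in(0,1)}F_s(u_s)<\infty$. Then for every sequence $(s_n)$ in $(0,1)$, in particular for every sequence $s_n\to0^+$, there are a subsequence $(s_{n_k})$ and a function $u\in L^2(\Omega)$ such that $u_{s_{n_k}}\rightharpoonup u$ weakly in $L^2(\Omega)$ as $k\to\infty$. (ii) That is, the functionals $F_s$, $s\in(0,1)$, are equi-coercive in the weak topology of $L^2(\Omega)$: for every $t\in[0,\infty)$ there is a weakly compact set $K\subset L^2(\Omega)$ such that, whenever $s\in(0,1)$ and $F_s(u)\le t$, the restriction of $u$ to $\Omega$ lies in $K$. -/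

import Mathlib

open Set Filter Topology MeasureTheory
open scoped NNReal ENNReal

noncomputable section

namespace MassAtInfinity

/-- `u` has finite `p`-mass at infinity equal to `a`: for all small `s > 0` the function
`u(y) / |y|^(d + s p)` is integrable outside the open unit ball centred at the origin, and
`s` times its integral there tends to `a` as `s → 0⁺`. -/
def HasMass {d : ℕ} (p : ℕ) (u : EuclideanSpace ℝ (Fin d) → ℝ) (a : ℝ) : Prop :=
  (∀ᶠ s : ℝ in 𝓝[>] 0,
    IntegrableOn (fun y => u y / ‖y‖ ^ ((d : ℝ) + s * p)) (Metric.ball 0 1)ᶜ) ∧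
  Tendsto (fun s : ℝ => s * ∫ y in (Metric.ball 0 1)ᶜ, u y / ‖y‖ ^ ((d : ℝ) + s * p))
    (𝓝[>] 0) (𝓝 a)

/-- The admissible boundary data `𝒜(Ω)`: functions in `L^∞(Ωᶜ)` such that `v⁺`, `v⁻` and `v²`
(extended by zero to `Ω`) have a finite `2`-mass at infinity. Only the values of `v` on `Ωᶜ`
matter. -/
def Admissible {d : ℕ} (Ω : Set (EuclideanSpace ℝ (Fin d))) :
    Set (EuclideanSpace ℝ (Fin d) → ℝ) :=
  {v | MemLp v ⊤ (volume.restrict Ωᶜ) ∧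
    (∃ a, HasMass 2 (Ωᶜ.indicator fun y => max (v y) 0) a) ∧
    (∃ a, HasMass 2 (Ωᶜ.indicator fun y => max (-v y) 0) a) ∧
    (∃ a, HasMass 2 (Ωᶜ.indicator fun y => v y ^ 2) a)}

/-- The functions in `L²_loc(ℝᵈ)` that agree with `v` almost everywhere on `Ωᶜ`. -/
def L2locWithDatum {d : ℕ} (Ω : Set (EuclideanSpace ℝ (Fin d)))
    (v : EuclideanSpace ℝ (Fin d) → ℝ) : Set (EuclideanSpace ℝ (Fin d) → ℝ) :=
  {u | (∀ K : Set (EuclideanSpace ℝ (Fin d)), IsCompact K → MemLp u 2 (volume.restrict K)) ∧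
    u =ᵐ[volume.restrict Ωᶜ] v}

/-- The region `Q_Ω = (ℝᵈ × ℝᵈ) \ (Ωᶜ × Ωᶜ)`. -/
def crossRegion {d : ℕ} (Ω : Set (EuclideanSpace ℝ (Fin d))) :
    Set (EuclideanSpace ℝ (Fin d) × EuclideanSpace ℝ (Fin d)) :=
  (Ωᶜ ×ˢ Ωᶜ)ᶜ

/-- The squared Gagliardo seminorm `[u]²_{H^s(Q_Ω)}`, with values in `[0, ∞]`. -/
def gagliardoSq {d : ℕ} (Ω : Set (EuclideanSpace ℝ (Fin d))) (s : ℝ)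
    (u : EuclideanSpace ℝ (Fin d) → ℝ) : ℝ≥0∞ :=
  ∫⁻ z in crossRegion Ω,
    ENNReal.ofReal (|u z.1 - u z.2| ^ 2 / ‖z.1 - z.2‖ ^ ((d : ℝ) + 2 * s))

open Classical in
/-- The functional `F_s(·, Ω)` with exterior datum `v`. -/
def energy {d : ℕ} (Ω : Set (EuclideanSpace ℝ (Fin d))) (v : EuclideanSpace ℝ (Fin d) → ℝ)
    (s : ℝ) (u : EuclideanSpace ℝ (Fin d) → ℝ) : ℝ≥0∞ :=
  if u ∈ L2locWithDatum Ω v then ENNReal.ofReal (s / 2) * gagliardoSq Ω s u else ⊤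

/-- The class in `L²(Ω)`, with its weak topology, of a function that is square integrable
on `Ω`. -/
def weakL2 {d : ℕ} {Ω : Set (EuclideanSpace ℝ (Fin d))} {u : EuclideanSpace ℝ (Fin d) → ℝ}
    (h : MemLp u 2 (volume.restrict Ω)) : WeakSpace ℝ (Lp ℝ 2 (volume.restrict Ω)) :=
  toWeakSpace ℝ (Lp ℝ 2 (volume.restrict Ω)) (h.toLp u)

end MassAtInfinity

end

/-!
For `x ∈ Ω` and `y` outside a large ball containing `Ω`, the datum bounds `|u y| = |v y|` by `M`, so
`|u x|² ≤ 2 |u x - u y|² + 2 M²`. Integrate this against `|2 y|^(-d-2s) ≤ |x - y|^(-d-2s)`. Outside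
the ball this kernel has total mass of order `1 / s` as `s → 0⁺`, which is exactly what the factor
`s` in the energy compensates: `F_s(u)` bounds `‖u‖²` in `L²(Ω)` uniformly in `s`. Closed balls of
`L²(Ω)` are weakly compact and, by separability, weakly sequentially compact.
-/

open Metric Module

section Hilbert

variable (𝕜 H : Type*) [RCLike 𝕜] [NormedAddCommGroup H] [InnerProductSpace 𝕜 H] [CompleteSpace H]

/-- The Riesz isomorphism of a Hilbert space, regarded as a map from the dual with its weak-star
topology to the space with its weak topology. It transports the Banach–Alaoglu theorems. -/
noncomputable def weakDualToWeakSpace (f : WeakDual 𝕜 H) : WeakSpace 𝕜 H :=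
  toWeakSpace 𝕜 H ((InnerProductSpace.toDual 𝕜 H).symm (WeakDual.toStrongDual f))

theorem continuous_weakDualToWeakSpace : Continuous (weakDualToWeakSpace 𝕜 H) := by
  refine WeakBilin.continuous_of_continuous_eval _ fun g => ?_
  set y := (InnerProductSpace.toDual 𝕜 H).symm g
  have eval_eq (f : WeakDual 𝕜 H) :
      g ((InnerProductSpace.toDual 𝕜 H).symm (WeakDual.toStrongDual f)) = star (f y) := by
    rw [← InnerProductSpace.toDual_symm_apply (y := g), ← inner_conj_symm,
      InnerProductSpace.toDual_symm_apply]
    rfl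
  exact (WeakDual.eval_continuous y).star.congr fun f => (eval_eq f).symm

variable {H}

theorem image_weakDualToWeakSpace_closedBall (x : H) (r : ℝ) :
    weakDualToWeakSpace 𝕜 H ''
        (WeakDual.toStrongDual ⁻¹' closedBall (InnerProductSpace.toDual 𝕜 H x) r) =
      toWeakSpace 𝕜 H '' closedBall x r := by
  ext y
  constructor
  · rintro ⟨f, hf, rfl⟩
    refine ⟨_, ?_, rfl⟩
    rwa [mem_closedBall, ← (InnerProductSpace.toDual 𝕜 H).dist_map,
      LinearIsometryEquiv.apply_symm_apply]
  · rintro ⟨z, hz, rfl⟩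
    refine ⟨StrongDual.toWeakDual (InnerProductSpace.toDual 𝕜 H z), ?_, ?_⟩
    · simpa using hz
    · simp [weakDualToWeakSpace]

theorem isCompact_toWeakSpace_image_closedBall (x : H) (r : ℝ) :
    IsCompact (toWeakSpace 𝕜 H '' closedBall x r) := by
  rw [← image_weakDualToWeakSpace_closedBall]
  exact (WeakDual.isCompact_closedBall _ r).image (continuous_weakDualToWeakSpace 𝕜 H)

theorem isSeqCompact_toWeakSpace_image_closedBall [TopologicalSpace.SeparableSpace H]
    (x : H) (r : ℝ) : IsSeqCompact (toWeakSpace 𝕜 H '' closedBall x r) := by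
  rw [← image_weakDualToWeakSpace_closedBall]
  exact (WeakDual.isSeqCompact_closedBall 𝕜 H _ r).image
    (continuous_weakDualToWeakSpace 𝕜 H).seqContinuous

end Hilbert

section PolarCoordinates

theorem indicator_fun_norm {E F : Type*} [SeminormedAddCommGroup E] [Zero F] (f : ℝ → F) (R : ℝ) :
    (fun x : E => (Ioi R).indicator f ‖x‖) = (closedBall 0 R)ᶜ.indicator fun x => f ‖x‖ := by
  ext x
  simp [indicator]

variable {E F : Type*} [NormedAddCommGroup E] [NormedSpace ℝ E] [FiniteDimensional ℝ E]
  [Nontrivial E] [MeasurableSpace E] [BorelSpace E] (μ : Measure E) [μ.IsAddHaarMeasure]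
  [NormedAddCommGroup F] [NormedSpace ℝ F] {R : ℝ}

theorem integrableOn_compl_closedBall_fun_norm_addHaar {f : ℝ → F} (hR : 0 ≤ R) :
    IntegrableOn (fun x : E => f ‖x‖) (closedBall 0 R)ᶜ μ ↔
      IntegrableOn (fun r => r ^ (finrank ℝ E - 1) • f r) (Ioi R) := by
  rw [← integrable_indicator_iff measurableSet_closedBall.compl, ← indicator_fun_norm,
    integrable_fun_norm_addHaar, ← indicator_smul, integrableOn_indicator_iff measurableSet_Ioi,
    inter_eq_left.2 (Ioi_subset_Ioi hR)]

theorem setIntegral_compl_closedBall_fun_norm_addHaar (f : ℝ → F) (hR : 0 ≤ R) :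
    ∫ x in (closedBall (0 : E) R)ᶜ, f ‖x‖ ∂μ =
      finrank ℝ E • μ.real (ball 0 1) • ∫ r in Ioi R, r ^ (finrank ℝ E - 1) • f r := by
  rw [← integral_indicator measurableSet_closedBall.compl, ← indicator_fun_norm,
    integral_fun_norm_addHaar, ← indicator_smul, setIntegral_indicator measurableSet_Ioi,
    inter_eq_right.2 (Ioi_subset_Ioi hR)]

theorem lintegral_compl_closedBall_norm_rpow_neg {p : ℝ} (hR : 0 < R) (hp : finrank ℝ E < p) :
    ∫⁻ x in (closedBall (0 : E) R)ᶜ, ENNReal.ofReal (‖x‖ ^ (-p)) ∂μ =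
      ENNReal.ofReal (finrank ℝ E * μ.real (ball 0 1) *
        (R ^ (finrank ℝ E - p) / (p - finrank ℝ E))) := by
  have radial : EqOn (fun r : ℝ => r ^ (finrank ℝ E - 1) • r ^ (-p))
      (fun r => r ^ (finrank ℝ E - 1 - p)) (Ioi R) := fun r hr => by
    simp only [smul_eq_mul]
    rw [← Real.rpow_natCast, ← Real.rpow_add (hR.trans hr),
      Nat.cast_pred finrank_pos, ← sub_eq_add_neg]
  have exponent_lt : finrank ℝ E - 1 - p < -1 := by linarith
  have integrable : IntegrableOn (fun x : E => ‖x‖ ^ (-p)) (closedBall 0 R)ᶜ μ := by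
    rw [integrableOn_compl_closedBall_fun_norm_addHaar μ (f := (· ^ (-p))) hR.le,
      integrableOn_congr_fun radial measurableSet_Ioi]
    exact integrableOn_Ioi_rpow_of_lt exponent_lt hR
  rw [← ofReal_integral_eq_lintegral_ofReal integrable (ae_of_all _ fun x => by positivity),
    setIntegral_compl_closedBall_fun_norm_addHaar μ (· ^ (-p)) hR.le,
    setIntegral_congr_fun measurableSet_Ioi radial, integral_Ioi_rpow_of_lt exponent_lt hR,
    nsmul_eq_mul, smul_eq_mul, ← mul_assoc, sub_right_comm, sub_add_cancel, neg_div, ← div_neg,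
    neg_sub]

end PolarCoordinates

theorem enorm_sq_le_two_mul_enorm_sub_sq_add {E : Type*} [SeminormedAddCommGroup E] (a b : E) :
    ‖a‖ₑ ^ 2 ≤ 2 * ‖a - b‖ₑ ^ 2 + 2 * ‖b‖ₑ ^ 2 := by
  calc ‖a‖ₑ ^ 2 ≤ (‖a - b‖ₑ + ‖b‖ₑ) ^ 2 := by
        gcongr
        simp only [enorm_eq_nnnorm]
        exact_mod_cast (nnnorm_le_nnnorm_add_nnnorm_sub' a b).trans_eq (add_comm _ _)
    _ ≤ 2 * (‖a - b‖ₑ ^ 2 + ‖b‖ₑ ^ 2) := by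
        simpa [show (2 : ℝ) - 1 = 1 by norm_num] using
          ENNReal.rpow_add_le_mul_rpow_add_rpow ‖a - b‖ₑ ‖b‖ₑ one_le_two
    _ = _ := mul_add _ _ _

theorem eLpNorm_two_sq_mul_lintegral_le {α β E : Type*} [MeasurableSpace α] [MeasurableSpace β]
    [NormedAddCommGroup E] {μ : Measure α} {ν : Measure β} [SFinite ν] {f : α → E}
    {k : β → ℝ≥0∞} (hf : AEStronglyMeasurable f μ) (g : β → E) (hk : AEMeasurable k ν) :
    eLpNorm f 2 μ ^ 2 * ∫⁻ y, k y ∂ν ≤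
      2 * ∫⁻ z, ‖f z.1 - g z.2‖ₑ ^ 2 * k z.2 ∂(μ.prod ν) +
        2 * eLpNorm g ⊤ ν ^ 2 * μ univ * ∫⁻ y, k y ∂ν := by
  set M := eLpNorm g ⊤ ν with hM
  have norm_sq : eLpNorm f 2 μ ^ 2 = ∫⁻ x, ‖f x‖ₑ ^ 2 ∂μ := by
    simpa using eLpNorm_nnreal_pow_eq_lintegral (f := f) (μ := μ) (p := 2) two_ne_zero
  have g_le : ∀ᵐ z ∂μ.prod ν, ‖g z.2‖ₑ ≤ M := by
    rw [hM, eLpNorm_exponent_top]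
    exact Measure.quasiMeasurePreserving_snd.ae ae_le_eLpNormEssSup
  have pointwise : ∀ᵐ z ∂μ.prod ν, ‖f z.1‖ₑ ^ 2 * k z.2 ≤
      2 * (‖f z.1 - g z.2‖ₑ ^ 2 * k z.2) + 2 * M ^ 2 * k z.2 := by
    filter_upwards [g_le] with z hz
    rw [← mul_assoc, ← add_mul]
    gcongr
    exact (enorm_sq_le_two_mul_enorm_sub_sq_add (f z.1) (g z.2)).trans (by gcongr)
  calc eLpNorm f 2 μ ^ 2 * ∫⁻ y, k y ∂ν
      = ∫⁻ z, ‖f z.1‖ₑ ^ 2 * k z.2 ∂μ.prod ν := by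
        rw [norm_sq, lintegral_prod_mul (f := fun x => ‖f x‖ₑ ^ 2) (by fun_prop) hk]
    _ ≤ ∫⁻ z, 2 * (‖f z.1 - g z.2‖ₑ ^ 2 * k z.2) + 2 * M ^ 2 * k z.2 ∂μ.prod ν :=
        lintegral_mono_ae pointwise
    _ = _ := by
        rw [lintegral_add_right' _ (hk.comp_snd.const_mul _),
          lintegral_const_mul' _ _ ENNReal.ofNat_ne_top,
          lintegral_prod_mul (f := fun _ => 2 * M ^ 2) aemeasurable_const hk, lintegral_const]

theorem two_mul_norm_rpow_neg_le_norm_sub_rpow_neg {E : Type*} [SeminormedAddCommGroup E] {x y : E}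
    (hxy : ‖x‖ < ‖y‖) {p : ℝ} (hp : 0 ≤ p) : (2 * ‖y‖) ^ (-p) ≤ ‖x - y‖ ^ (-p) := by
  have norm_sub_pos : 0 < ‖x - y‖ :=
    (sub_pos.2 hxy).trans_le (by simpa [norm_sub_rev] using norm_sub_norm_le y x)
  have norm_sub_le : ‖x - y‖ ≤ 2 * ‖y‖ := (norm_sub_le x y).trans (by linarith)
  exact Real.rpow_le_rpow_of_nonpos norm_sub_pos norm_sub_le (neg_nonpos.2 hp)

namespace MassAtInfinity

variable {d : ℕ} {Ω : Set (EuclideanSpace ℝ (Fin d))} {v w : EuclideanSpace ℝ (Fin d) → ℝ}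
  {R s : ℝ}

/-- The mass outside the ball of radius `R` of the kernel `|2 y| ^ (-d - 2 s)`. The factor `2` makes
this kernel a lower bound of `|x - y| ^ (-d - 2 s)` for all `x` in the ball. -/
noncomputable def tailMass (d : ℕ) (R s : ℝ) : ℝ≥0∞ :=
  ∫⁻ y in (closedBall (0 : EuclideanSpace ℝ (Fin d)) R)ᶜ,
    ENNReal.ofReal ((2 * ‖y‖) ^ (-((d : ℝ) + 2 * s)))

theorem tailMass_eq_ofReal [NeZero d] (hR : 0 < R) (hs : 0 < s) :
    tailMass d R s = ENNReal.ofReal (2 ^ (-((d : ℝ) + 2 * s)) *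
      (d * volume.real (ball (0 : EuclideanSpace ℝ (Fin d)) 1) * (R ^ (-(2 * s)) / (2 * s)))) := by
  have tail := lintegral_compl_closedBall_norm_rpow_neg
    (volume : Measure (EuclideanSpace ℝ (Fin d))) hR (p := d + 2 * s)
    (by rw [finrank_euclideanSpace_fin]; linarith)
  rw [finrank_euclideanSpace_fin, sub_add_cancel_left, add_sub_cancel_left] at tail
  simp_rw [tailMass, Real.mul_rpow zero_le_two (norm_nonneg _)]
  rw [ENNReal.ofReal_mul (by positivity), ← tail,
    ← lintegral_const_mul' _ _ ENNReal.ofReal_ne_top]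
  simp_rw [← ENNReal.ofReal_mul (show (0 : ℝ) ≤ 2 ^ (-((d : ℝ) + 2 * s)) by positivity)]

theorem exists_pos_le_ofReal_mul_tailMass [NeZero d] (hR : 1 ≤ R) :
    ∃ c : ℝ≥0, 0 < c ∧ ∀ s ∈ Ioo (0 : ℝ) 1, c ≤ ENNReal.ofReal s * tailMass d R s := by
  set ω := volume.real (ball (0 : EuclideanSpace ℝ (Fin d)) 1)
  have ω_pos : 0 < ω := 
    ENNReal.toReal_pos (measure_ball_pos _ _ one_pos).ne' measure_ball_lt_top.ne
  have d_pos : (0 : ℝ) < d := Nat.cast_pos.2 (NeZero.pos d)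
  have R_pos : 0 < R := one_pos.trans_le hR
  refine ⟨(2 ^ (-((d : ℝ) + 2)) * (d * ω * (R ^ (-2 : ℝ) / 2))).toNNReal,
    Real.toNNReal_pos.2 (by positivity), fun s ⟨hs0, hs1⟩ => ?_⟩
  rw [tailMass_eq_ofReal R_pos hs0, ← ENNReal.ofReal_mul hs0.le]
  refine ENNReal.ofReal_le_ofReal ?_
  calc 2 ^ (-((d : ℝ) + 2)) * (d * ω * (R ^ (-2 : ℝ) / 2))
      ≤ 2 ^ (-((d : ℝ) + 2 * s)) * (d * ω * (R ^ (-(2 * s)) / 2)) := by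
        gcongr <;> linarith
    _ = s * (2 ^ (-((d : ℝ) + 2 * s)) * (d * ω * (R ^ (-(2 * s)) / (2 * s)))) := by
        field_simp

theorem lintegral_enorm_sub_sq_mul_le_gagliardoSq (hR : Ω ⊆ closedBall 0 R) (hs : 0 ≤ s)
    (u : EuclideanSpace ℝ (Fin d) → ℝ) :
    ∫⁻ z, ‖u z.1 - u z.2‖ₑ ^ 2 * ENNReal.ofReal ((2 * ‖z.2‖) ^ (-((d : ℝ) + 2 * s)))
        ∂((volume.restrict Ω).prod (volume.restrict (closedBall 0 R)ᶜ)) ≤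
      gagliardoSq Ω s u := by
  rw [Measure.prod_restrict]
  have mem_prod : ∀ᵐ z ∂(volume.prod volume).restrict
      (Ω ×ˢ (closedBall (0 : EuclideanSpace ℝ (Fin d)) R)ᶜ),
      z ∈ closedBall (0 : EuclideanSpace ℝ (Fin d)) R ×ˢ (closedBall 0 R)ᶜ :=
    ae_restrict_of_ae_restrict_of_subset (prod_mono_left hR)
      (ae_restrict_mem (measurableSet_closedBall.prod measurableSet_closedBall.compl))
  have subset_crossRegion : Ω ×ˢ (closedBall 0 R)ᶜ ⊆ crossRegion Ω := fun z hz hz' => hz'.1 hz.1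
  refine (lintegral_mono_ae ?_).trans (lintegral_mono_set subset_crossRegion)
  filter_upwards [mem_prod] with z ⟨hz1, hz2⟩
  have norm_lt : ‖z.1‖ < ‖z.2‖ := by
    rw [mem_closedBall_zero_iff] at hz1
    rw [mem_compl_iff, mem_closedBall_zero_iff, not_le] at hz2
    exact hz1.trans_lt hz2
  rw [div_eq_mul_inv, ← Real.rpow_neg (norm_nonneg _), ENNReal.ofReal_mul (by positivity),
    ENNReal.ofReal_pow (abs_nonneg _), ← Real.enorm_eq_ofReal_abs]
  gcongr _ * ENNReal.ofReal ?_
  exact two_mul_norm_rpow_neg_le_norm_sub_rpow_neg norm_lt (by positivity)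

theorem memLp_two_of_mem_L2locWithDatum (hΩ : Bornology.IsBounded Ω)
    (hw : w ∈ L2locWithDatum Ω v) : MemLp w 2 (volume.restrict Ω) :=
  (hw.1 _ hΩ.isCompact_closure).mono_measure (Measure.restrict_mono subset_closure le_rfl)

theorem mem_L2locWithDatum_of_energy_ne_top (h : energy Ω v s w ≠ ⊤) : w ∈ L2locWithDatum Ω v := by
  by_contra hw
  exact h (if_neg hw)

theorem eLpNorm_two_sq_mul_tailMass_le (hR : Ω ⊆ closedBall 0 R) (hs : 0 ≤ s)
    (hw : w ∈ L2locWithDatum Ω v) :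
    eLpNorm w 2 (volume.restrict Ω) ^ 2 * tailMass d R s ≤
      2 * gagliardoSq Ω s w +
        2 * eLpNorm v ⊤ (volume.restrict Ωᶜ) ^ 2 * volume Ω * tailMass d R s := by
  have eLpNorm_top_le : eLpNorm w ⊤ (volume.restrict (closedBall 0 R)ᶜ) ≤
      eLpNorm v ⊤ (volume.restrict Ωᶜ) := by
    rw [← eLpNorm_congr_ae hw.2]
    exact eLpNorm_mono_measure _ (Measure.restrict_mono (compl_subset_compl.2 hR) le_rfl)
  have w_aesm := (memLp_two_of_mem_L2locWithDatum (isBounded_closedBall.subset hR) hw).1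
  refine (eLpNorm_two_sq_mul_lintegral_le w_aesm w (by fun_prop)).trans ?_
  rw [Measure.restrict_apply_univ, ← tailMass]
  gcongr
  exact lintegral_enorm_sub_sq_mul_le_gagliardoSq hR hs w

theorem exists_eLpNorm_two_sq_le_add_mul_energy [NeZero d] (hΩ : Bornology.IsBounded Ω)
    (v : EuclideanSpace ℝ (Fin d) → ℝ) :
    ∃ B : ℝ≥0, ∀ s ∈ Ioo (0 : ℝ) 1, ∀ w ∈ L2locWithDatum Ω v,
      eLpNorm w 2 (volume.restrict Ω) ^ 2 ≤
        2 * eLpNorm v ⊤ (volume.restrict Ωᶜ) ^ 2 * volume Ω + B * energy Ω v s w := by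
  obtain ⟨R, hR, hΩR⟩ : ∃ R, 1 ≤ R ∧ Ω ⊆ closedBall 0 R := by
    obtain ⟨r, hr⟩ := hΩ.subset_closedBall 0
    exact ⟨max r 1, le_max_right _ _, hr.trans (closedBall_subset_closedBall (le_max_left _ _))⟩
  obtain ⟨c, c_pos, hc⟩ := exists_pos_le_ofReal_mul_tailMass (d := d) hR
  refine ⟨4 / c, fun s hs w hw => ?_⟩
  set A := 2 * eLpNorm v ⊤ (volume.restrict Ωᶜ) ^ 2 * volume Ω
  set τ := ENNReal.ofReal s * tailMass d R s with hτ
  have τ_ne_zero : τ ≠ 0 := ((ENNReal.coe_pos.2 c_pos).trans_le (hc s hs)).ne'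
  have τ_ne_top : τ ≠ ⊤ := by
    rw [hτ, tailMass_eq_ofReal (one_pos.trans_le hR) hs.1]
    exact ENNReal.mul_ne_top ENNReal.ofReal_ne_top ENNReal.ofReal_ne_top
  have four_mul_energy : ENNReal.ofReal s * (2 * gagliardoSq Ω s w) = 4 * energy Ω v s w := by
    rw [energy, if_pos hw, ← mul_assoc, ← mul_assoc, ← ENNReal.ofReal_ofNat 2,
      ← ENNReal.ofReal_ofNat 4, ← ENNReal.ofReal_mul hs.1.le, ← ENNReal.ofReal_mul zero_le_four]
    ring_nf
  have mul_τ_le : eLpNorm w 2 (volume.restrict Ω) ^ 2 * τ ≤ A * τ + 4 * energy Ω v s w := by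
    calc eLpNorm w 2 (volume.restrict Ω) ^ 2 * τ
        = ENNReal.ofReal s * (eLpNorm w 2 (volume.restrict Ω) ^ 2 * tailMass d R s) := by ring
      _ ≤ ENNReal.ofReal s * (2 * gagliardoSq Ω s w + A * tailMass d R s) := by
          gcongr
          exact eLpNorm_two_sq_mul_tailMass_le hΩR hs.1.le hw
      _ = A * τ + 4 * energy Ω v s w := by rw [mul_add, four_mul_energy]; ring
  calc eLpNorm w 2 (volume.restrict Ω) ^ 2
      ≤ (A * τ + 4 * energy Ω v s w) / τ :=
        (ENNReal.le_div_iff_mul_le (.inl τ_ne_zero) (.inl τ_ne_top)).2 mul_τ_le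
    _ = A + 4 / τ * energy Ω v s w := by
        rw [ENNReal.add_div, ENNReal.mul_div_cancel_right τ_ne_zero τ_ne_top,
          ENNReal.mul_div_right_comm]
    _ ≤ A + (4 / c : ℝ≥0) * energy Ω v s w := by
        rw [ENNReal.coe_div c_pos.ne', ENNReal.coe_ofNat]
        gcongr
        exact hc s hs

theorem exists_weakL2_mem_closedBall_of_energy_le [NeZero d] (hΩ : Bornology.IsBounded Ω)
    (hv : MemLp v ⊤ (volume.restrict Ωᶜ)) (t : ℝ≥0) :
    ∃ r : ℝ, ∀ s ∈ Ioo (0 : ℝ) 1, ∀ w : EuclideanSpace ℝ (Fin d) → ℝ, energy Ω v s w ≤ t →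
      ∃ h : MemLp w 2 (volume.restrict Ω),
        weakL2 h ∈ toWeakSpace ℝ (Lp ℝ 2 (volume.restrict Ω)) '' closedBall 0 r := by
  obtain ⟨B, hB⟩ := exists_eLpNorm_two_sq_le_add_mul_energy hΩ v
  set C := 2 * eLpNorm v ⊤ (volume.restrict Ωᶜ) ^ 2 * volume Ω + B * t
  have C_ne_top : C ≠ ⊤ := by
    have := hv.eLpNorm_ne_top
    have := hΩ.measure_lt_top (μ := volume).ne
    finiteness
  refine ⟨√C.toReal, fun s hs w hwt => ?_⟩
  have hw := mem_L2locWithDatum_of_energy_ne_top (hwt.trans_lt ENNReal.coe_lt_top).ne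
  have h := memLp_two_of_mem_L2locWithDatum hΩ hw
  refine ⟨h, mem_image_of_mem _ ?_⟩
  rw [mem_closedBall_zero_iff, Lp.norm_toLp]
  refine Real.le_sqrt_of_sq_le ?_
  rw [← ENNReal.toReal_pow]
  exact ENNReal.toReal_mono C_ne_top ((hB s hs w hw).trans (by unfold C; gcongr))

end MassAtInfinity

theorem mainTheorem7_general {d : ℕ} (hd : 1 ≤ d) {Ω : Set (EuclideanSpace ℝ (Fin d))}
    (hΩ : Bornology.IsBounded Ω) {v : EuclideanSpace ℝ (Fin d) → ℝ}
    (hv : MemLp v ⊤ (volume.restrict Ωᶜ)) :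
    (∀ (σ : ℕ → ℝ) (u : ℕ → EuclideanSpace ℝ (Fin d) → ℝ), (∀ n, σ n ∈ Ioo (0 : ℝ) 1) →
      (⨆ n, MassAtInfinity.energy Ω v (σ n) (u n)) < ⊤ →
        ∃ φ : ℕ → ℕ, StrictMono φ ∧
          ∃ h : ∀ n, MemLp (u (φ n)) 2 (volume.restrict Ω),
            ∃ u₀ : EuclideanSpace ℝ (Fin d) → ℝ, ∃ h₀ : MemLp u₀ 2 (volume.restrict Ω),
              Tendsto (fun n => MassAtInfinity.weakL2 (h n)) atTop
                (𝓝 (MassAtInfinity.weakL2 h₀))) ∧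
    (∀ t : ℝ≥0, ∃ K : Set (WeakSpace ℝ (Lp ℝ 2 (volume.restrict Ω))), IsCompact K ∧
      ∀ s ∈ Ioo (0 : ℝ) 1, ∀ w : EuclideanSpace ℝ (Fin d) → ℝ,
        MassAtInfinity.energy Ω v s w ≤ t →
          ∃ h : MemLp w 2 (volume.restrict Ω), MassAtInfinity.weakL2 h ∈ K) := by
  have : NeZero d := ⟨by lia⟩
  have : Fact ((2 : ℝ≥0∞) ≠ ⊤) := ⟨ENNReal.ofNat_ne_top⟩
  have bounded := MassAtInfinity.exists_weakL2_mem_closedBall_of_energy_le hΩ hv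
  refine ⟨fun σ u hσ hE => ?_, fun t => ?_⟩
  · lift (⨆ n, MassAtInfinity.energy Ω v (σ n) (u n)) to ℝ≥0 using hE.ne with t ht
    obtain ⟨r, hr⟩ := bounded t
    choose h h_mem using fun n => hr (σ n) (hσ n) (u n) ((le_iSup _ n).trans ht.ge)
    obtain ⟨_, ⟨u₀, -, rfl⟩, φ, φ_mono, hφ⟩ :=
      isSeqCompact_toWeakSpace_image_closedBall ℝ _ r h_mem
    refine ⟨φ, φ_mono, fun n => h (φ n), u₀, Lp.memLp u₀, ?_⟩
    rwa [MassAtInfinity.weakL2, Lp.toLp_coeFn]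
  · obtain ⟨r, hr⟩ := bounded t
    exact ⟨_, isCompact_toWeakSpace_image_closedBall ℝ 0 r, hr⟩

theorem mainTheorem7 {d : ℕ} (hd : 1 ≤ d) (Ω : Set (EuclideanSpace ℝ (Fin d)))
    (hΩo : IsOpen Ω) (hΩb : Bornology.IsBounded Ω)
    (v : EuclideanSpace ℝ (Fin d) → ℝ) (hv : v ∈ MassAtInfinity.Admissible Ω) :
    -- compactness of families with bounded energy
    (∀ u : ℝ → EuclideanSpace ℝ (Fin d) → ℝ,
      (∀ s ∈ Ioo (0 : ℝ) 1, u s ∈ MassAtInfinity.L2locWithDatum Ω v) →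
      (⨆ s ∈ Ioo (0 : ℝ) 1, MassAtInfinity.energy Ω v s (u s)) < ⊤ →
      ∀ σ : ℕ → ℝ, (∀ n, σ n ∈ Ioo (0 : ℝ) 1) →
        ∃ φ : ℕ → ℕ, StrictMono φ ∧
          ∃ h : ∀ n, MemLp (u (σ (φ n))) 2 (volume.restrict Ω),
            ∃ u₀ : EuclideanSpace ℝ (Fin d) → ℝ, ∃ h₀ : MemLp u₀ 2 (volume.restrict Ω),
              Tendsto (fun n => MassAtInfinity.weakL2 (h n)) atTop
                (𝓝 (MassAtInfinity.weakL2 h₀))) ∧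
    -- equi-coercivity in the weak topology of `L²(Ω)`
    (∀ t : ℝ≥0, ∃ K : Set (WeakSpace ℝ (Lp ℝ 2 (volume.restrict Ω))), IsCompact K ∧
      ∀ s ∈ Ioo (0 : ℝ) 1, ∀ w : EuclideanSpace ℝ (Fin d) → ℝ,
        MassAtInfinity.energy Ω v s w ≤ t →
          ∃ h : MemLp w 2 (volume.restrict Ω), MassAtInfinity.weakL2 h ∈ K) := by
  have general := mainTheorem7_general hd hΩb hv.1
  exact ⟨fun u _ hE σ hσ => general.1 σ (fun n => u (σ n)) hσ
    ((iSup_le fun n => le_iSup₂_of_le (σ n) (hσ n) le_rfl).trans_lt hE), general.2⟩
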